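/- Theorem 1.2. Let $p$ be an odd prime. For rational numbers $x,y$ and an integer $m\ge 1$ write $x\equiv y\pmod m$ if $x-y=m\cdot a/b$ with integers $a,b$, $b\ge1$ and $\gcd(b,m)=1$. Then $$\sum_{k=0}^{p-1}\frac{(-1)^k(172k^2+75k+9)}{2^{12k}}\binom{2k}{k}^3\binom{3k}{k}\binom{4k}{2k}\equiv 9p^2\pmod{p^5},$$ and, in hypergeometric form, $$\sum_{n=0}^{p-1}\frac{\left(\frac12\right)_n\left(\frac13\right)_n\left(\frac23\right)_n\left(\frac14\right)_n\left(\frac34\right)_n}{(1)_n^5}(-1)^n\left(172n^2+75n+9\right)\left(\frac{27}{16}\right)^n\equiv 9p^2\pmod{p^5},$$ where $(a)_n=\prod_{j=0}^{n-1}(a+j)$ is the rising factorial. -/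

import Mathlib

/-- The rising factorial `(a)_n = a (a + 1) ⋯ (a + n - 1)` of a rational number. -/
noncomputable def rising (a : ℚ) (n : ℕ) : ℚ := (ascPochhammer ℚ n).eval a

/-- Congruence of rational numbers modulo a positive integer `m`: the difference `x - y` is `m`
times a fraction whose denominator is coprime to `m`. -/
def RatModEq (m : ℕ) (x y : ℚ) : Prop :=
  ∃ (a : ℤ) (b : ℕ), 0 < b ∧ b.Coprime m ∧ x - y = (m : ℚ) * ((a : ℚ) / (b : ℚ))

/-!
The congruence is the shadow of a WZ pair. Dougall's `5H5` summation, shifted along a suitable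
direction of its parameters, gives a hypergeometric function `F(n, k)` and a companion `G(n, k)`
with

  `F(n, k + 1) - F(n, k) = G(n + 1, k) - G(n, k)`,

such that `F(n, 0)` is the summand of the theorem (in either of its two forms), `F(n, k) = 0` for
`n < 2 * k` and `G(n, k) = 0` for `n ≤ 2 * k`. Because of this support the functions are written in
the offset variable `m`, as `wzF k m` with `n = 2 * k + m` and `wzG k m` with `n = 2 * k + m + 1`.
Each of the three relations `wzF_offset_zero`, `wzF_offset_one`, `wzF_succ_sub` is a rational
function identity.

Write `p = 2 * K + 1`. Summing over `n < p` and letting `k` run from `0` to `K` (`sum_wzF_zero`)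
turns the sum into the single term `F(p - 1, K)` minus the boundary terms `G(p, k)` with `k < K`.
Counting the factors `p` in the factorials and in the products `(1/2)_n` shows that every boundary
term is divisible by `p ^ 5` (`wzG_powDvd`).

The surviving term is `48 (1/2)_{2p} (1/2)_p² / (((3p-1)/2)! ((p-1)/2)!)²`. Its products are
symmetric about `p / 2`, `3p / 2` and `p`, hence it equals
`9 p² ∏_{i ≤ K} (1 - p²/4i²)³ (1 - 9p²/4i²) / (1 - p²/i²)²` (`wzF_offset_zero_eq_prod`). Each factor
is `1 - p²/i² + O(p⁴)`, and `9 ∑_{i ≤ K} 1/i²` is divisible by `p` (`powDvd_sum_inv_sq`), so that the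
term is `9 p²` modulo `p ^ 5`.
-/

open Finset Nat

/-! ### Rising factorials -/

lemma rising_zero (a : ℚ) : rising a 0 = 1 := by simp [rising]

lemma rising_succ (a : ℚ) (n : ℕ) : rising a (n + 1) = rising a n * (a + n) := by
  simp [rising, ascPochhammer_succ_eval]

lemma rising_pos {a : ℚ} (ha : 0 < a) (n : ℕ) : 0 < rising a n := by
  induction n with
  | zero => simp [rising_zero]
  | succ n ih => rw [rising_succ]; positivity

lemma rising_add (a : ℚ) (m n : ℕ) : rising a (m + n) = rising a m * rising (a + m) n := by
  induction n with
  | zero => simp [rising_zero]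
  | succ n ih => rw [← add_assoc, rising_succ, rising_succ, ih]; push_cast; ring

lemma rising_one (n : ℕ) : rising 1 n = n ! := by
  induction n with
  | zero => simp [rising_zero]
  | succ n ih => rw [rising_succ, ih, factorial_succ]; push_cast; ring

lemma factorial_add_eq_mul_rising (m n : ℕ) :
    ((m + n)! : ℚ) = m ! * rising (m + 1) n := by
  rw [← rising_one, rising_add, rising_one, add_comm (1 : ℚ)]

lemma rising_half (n : ℕ) : rising (1 / 2) n = (2 * n)! / (4 ^ n * n !) := by
  induction n with
  | zero => simp [rising_zero]
  | succ n ih =>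
    rw [rising_succ, ih, show 2 * (n + 1) = 2 * n + 1 + 1 by ring]
    simp only [factorial_succ]
    push_cast
    field_simp
    ring

lemma rising_thirds (n : ℕ) :
    rising (1 / 3) n * rising (2 / 3) n = (3 * n)! / (27 ^ n * n !) := by
  induction n with
  | zero => simp [rising_zero]
  | succ n ih =>
    rw [rising_succ, rising_succ, mul_mul_mul_comm, ih,
      show 3 * (n + 1) = 3 * n + 1 + 1 + 1 by ring]
    simp only [factorial_succ]
    push_cast
    field_simp
    ring

lemma rising_quarters (n : ℕ) :
    rising (1 / 4) n * rising (3 / 4) n = (4 * n)! / (64 ^ n * (2 * n)!) := by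
  induction n with
  | zero => simp [rising_zero]
  | succ n ih =>
    rw [rising_succ, rising_succ, mul_mul_mul_comm, ih,
      show 4 * (n + 1) = 4 * n + 1 + 1 + 1 + 1 by ring, show 2 * (n + 1) = 2 * n + 1 + 1 by ring]
    simp only [factorial_succ]
    push_cast
    field_simp
    ring

/-- Both forms of the summand equal `(-1)^n (172 n² + 75 n + 9) (4n)! (3n)! / (2^(12n) n!^7)`. -/
lemma binomial_summand_eq (k : ℕ) :
    (-1 : ℚ) ^ k * (172 * (k : ℚ) ^ 2 + 75 * (k : ℚ) + 9) / 2 ^ (12 * k)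
          * ((2 * k).choose k : ℚ) ^ 3 * ((3 * k).choose k : ℚ) * ((4 * k).choose (2 * k) : ℚ)
      = (-1) ^ k * (172 * (k : ℚ) ^ 2 + 75 * k + 9) * ((4 * k)! * (3 * k)!)
          / (2 ^ (12 * k) * (k ! : ℚ) ^ 7) := by
  rw [cast_choose ℚ (show k ≤ 2 * k by omega), cast_choose ℚ (show k ≤ 3 * k by omega),
    cast_choose ℚ (show 2 * k ≤ 4 * k by omega), show 2 * k - k = k by omega,
    show 3 * k - k = 2 * k by omega, show 4 * k - 2 * k = 2 * k by omega]
  field_simp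

lemma hypergeometric_summand_eq (n : ℕ) :
    (rising (1 / 2) n * rising (1 / 3) n * rising (2 / 3) n * rising (1 / 4) n
            * rising (3 / 4) n) / rising 1 n ^ 5
          * (-1 : ℚ) ^ n * (172 * (n : ℚ) ^ 2 + 75 * (n : ℚ) + 9) * (27 / 16 : ℚ) ^ n
      = (-1) ^ n * (172 * (n : ℚ) ^ 2 + 75 * n + 9) * ((4 * n)! * (3 * n)!)
          / (2 ^ (12 * n) * (n ! : ℚ) ^ 7) := by
  have h : rising (1 / 2) n * rising (1 / 3) n * rising (2 / 3) n * rising (1 / 4) n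
      * rising (3 / 4) n = rising (1 / 2) n * (rising (1 / 3) n * rising (2 / 3) n) *
        (rising (1 / 4) n * rising (3 / 4) n) := by ring
  have h2 : (2 : ℚ) ^ (12 * n) = 4 ^ n * 64 ^ n * 16 ^ n := by
    rw [pow_mul, ← mul_pow, ← mul_pow]; norm_num
  rw [h, rising_half, rising_thirds, rising_quarters, rising_one, h2, div_pow]
  field_simp

/-! ### The WZ pair -/

/-- The polynomial factor of the WZ function `wzF`, in terms of `n` and `k`. -/
def wzNum (n k : ℚ) : ℚ :=
  688 * n ^ 5 + (988 - 1888 * k) * n ^ 4 + (508 - 2200 * k + 1984 * k ^ 2) * n ^ 3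
    + (111 - 860 * k + 1756 * k ^ 2 - 1024 * k ^ 3) * n ^ 2
    + (9 - 128 * k + 464 * k ^ 2 - 608 * k ^ 3 + 272 * k ^ 4) * n
    - 6 * k + 36 * k ^ 2 - 80 * k ^ 3 + 80 * k ^ 4 - 32 * k ^ 5

/-- The polynomial factor of the WZ companion `wzG`, in terms of `n` and `k`. -/
def wzCert (n k : ℚ) : ℚ :=
  48 + 208 * k + 288 * k ^ 2 + 128 * k ^ 3 - (184 + 544 * k + 384 * k ^ 2) * n
    + (208 + 320 * k) * n ^ 2 - 64 * n ^ 3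

/-- The WZ function at `(n, k)` with `n = 2 * k + m`; it would vanish for `n < 2 * k`, so the
offset `m` is used as the variable. The quotient `3 * wzNum n k / (3 * n - 2 * k)` is `0 / 0`
at `n = k = 0`, where its value along `k = 0` is `9`. -/
noncomputable def wzF (k m : ℕ) : ℚ :=
  (-1) ^ m * rising (1 / 2) (4 * k + 2 * m) * rising (1 / 2) (2 * k + m) ^ 2
      * rising (1 / 2) (k + m) ^ 2 * (4 * k + 3 * m)!
      * (if k = 0 ∧ m = 0 then 9 else 3 * wzNum (2 * k + m) k / (4 * k + 3 * m))
    / ((4 * k + 2 * m)! * (3 * k + 2 * m + 1)! ^ 2 * (k + m)! ^ 2 * m ! * rising (1 / 2) k ^ 2)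

/-- The WZ companion of `wzF` at `(n, k)` with `n = 2 * k + m + 1`; it would vanish for
`n ≤ 2 * k`. -/
noncomputable def wzG (k m : ℕ) : ℚ :=
  (-1) ^ (m + 1) * rising (1 / 2) (4 * k + 2 * m + 2) * rising (1 / 2) (2 * k + m + 1) ^ 2
      * rising (1 / 2) (k + m) ^ 2 * (4 * k + 3 * m)! * (2 * k + m + 1)
      * (3 * wzCert (2 * k + m + 1) k)
    / ((4 * k + 2 * m + 2)! * (3 * k + 2 * m + 1)! ^ 2 * (k + m)! ^ 2 * m !
      * rising (1 / 2) (k + 1) ^ 2)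

lemma wzF_zero_left (n : ℕ) :
    wzF 0 n = (-1) ^ n * (172 * (n : ℚ) ^ 2 + 75 * n + 9) * ((4 * n)! * (3 * n)!)
          / (2 ^ (12 * n) * (n ! : ℚ) ^ 7) := by
  rcases Nat.eq_zero_or_pos n with rfl | hn
  · simp [wzF, rising_zero]
  · have hn' : (n : ℚ) ≠ 0 := by positivity
    have h2 : (2 : ℚ) ^ (12 * n) = 4 ^ (2 * n) * 4 ^ n * 4 ^ n * 4 ^ n * 4 ^ n := by
      rw [pow_mul, pow_mul, ← mul_pow, ← mul_pow, ← mul_pow, ← mul_pow]; norm_num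
    simp only [wzF, hn.ne', and_false, if_false, wzNum, mul_zero, zero_add, rising_zero, h2,
      rising_half, factorial_succ, show 2 * (2 * n) = 4 * n by ring]
    push_cast
    field_simp
    ring

lemma wzF_offset_zero (k : ℕ) : wzF k 0 = -wzG k 0 := by
  rcases Nat.eq_zero_or_pos k with rfl | hk
  · simp [wzF, wzG, rising_zero, rising_succ, wzCert]
    norm_num
  · have hk' : (k : ℚ) ≠ 0 := by positivity
    have h1 := (rising_pos (show (0 : ℚ) < 1 / 2 by norm_num) k).ne'
    simp only [wzF, wzG, hk.ne', false_and, if_false, wzNum, wzCert, rising_succ, factorial_succ,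
      mul_zero, add_zero, zero_add]
    push_cast
    field_simp
    ring

lemma wzF_offset_one (k : ℕ) : -wzF k 1 = wzG k 1 - wzG k 0 := by
  have h1 := (rising_pos (show (0 : ℚ) < 1 / 2 by norm_num) k).ne'
  have h2 := (rising_pos (show (0 : ℚ) < 1 / 2 by norm_num) (4 * k)).ne'
  simp only [wzF, wzG, one_ne_zero, and_false, if_false, wzNum, wzCert,
    show 4 * k + 2 * 1 + 2 = 4 * k + 1 + 1 + 1 + 1 by ring,
    show 4 * k + 2 * 1 = 4 * k + 1 + 1 by ring,
    show 3 * k + 2 * 1 + 1 = 3 * k + 1 + 1 + 1 by ring,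
    show 4 * k + 3 * 1 = 4 * k + 1 + 1 + 1 by ring,
    rising_succ, factorial_succ, mul_zero, add_zero, zero_add]
  push_cast
  field_simp
  ring

/-- The WZ equation `F(n, k + 1) - F(n, k) = G(n + 1, k) - G(n, k)` for `n = 2 * k + m + 2`. -/
lemma wzF_succ_sub (k m : ℕ) :
    wzF (k + 1) m - wzF k (m + 2) = wzG k (m + 2) - wzG k (m + 1) := by
  have h1 := (rising_pos (show (0 : ℚ) < 1 / 2 by norm_num) k).ne'
  simp only [wzF, wzG, add_eq_zero, one_ne_zero, and_false, false_and,
    if_false, wzNum, wzCert,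
    show 4 * (k + 1) + 2 * m = 4 * k + 2 * m + 1 + 1 + 1 + 1 by ring,
    show 4 * k + 2 * (m + 1) + 2 = 4 * k + 2 * m + 1 + 1 + 1 + 1 by ring,
    show 4 * k + 2 * (m + 2) = 4 * k + 2 * m + 1 + 1 + 1 + 1 by ring,
    show 2 * (k + 1) + m = 2 * k + m + 1 + 1 by ring,
    show 2 * k + (m + 1) + 1 = 2 * k + m + 1 + 1 by ring,
    show 2 * k + (m + 2) = 2 * k + m + 1 + 1 by ring,
    show k + 1 + m = k + m + 1 by ring,
    show k + (m + 2) = k + m + 1 + 1 by ring,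
    show k + (m + 1) = k + m + 1 by ring,
    show 4 * (k + 1) + 3 * m = 4 * k + 3 * m + 3 + 1 by ring,
    show 4 * k + 3 * (m + 2) = 4 * k + 3 * m + 3 + 1 + 1 + 1 by ring,
    show 4 * k + 3 * (m + 1) = 4 * k + 3 * m + 3 by ring,
    show 3 * (k + 1) + 2 * m + 1 = 3 * k + 2 * m + 3 + 1 by ring,
    show 3 * k + 2 * (m + 2) + 1 = 3 * k + 2 * m + 3 + 1 + 1 by ring,
    show 3 * k + 2 * (m + 1) + 1 = 3 * k + 2 * m + 3 by ring,
    show m + 2 = m + 1 + 1 by ring,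
    rising_succ, factorial_succ, pow_succ (-1 : ℚ)]
  push_cast
  field_simp
  ring

lemma sum_wzF_succ (k M : ℕ) :
    ∑ m ∈ range M, wzF (k + 1) m = ∑ m ∈ range (M + 2), wzF k m + wzG k (M + 1) := by
  induction M with
  | zero =>
    have h0 := wzF_offset_zero k
    have h1 := wzF_offset_one k
    simp only [range_zero, sum_empty, sum_range_succ, zero_add]
    linarith
  | succ M ih =>
    have h := wzF_succ_sub k M
    rw [sum_range_succ, ih, show M + 1 + 2 = M + 2 + 1 by ring, sum_range_succ _ (M + 2)]
    linarith

/-- Summing the WZ equation over `n < 2 * K + 1` and moving `k` from `0` to `K` leaves a single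
term, since `wzF` at `k = K` lives on `n ≥ 2 * K`. -/
lemma sum_wzF_zero (K : ℕ) :
    ∑ m ∈ range (2 * K + 1), wzF 0 m
      = wzF K 0 - ∑ k ∈ range K, wzG k (2 * (K - k)) := by
  have key : ∀ j ≤ K, ∑ m ∈ range (2 * K + 1), wzF 0 m
      = ∑ m ∈ range (2 * (K - j) + 1), wzF j m - ∑ k ∈ range j, wzG k (2 * (K - k)) := by
    intro j hj
    induction j with
    | zero => simp
    | succ j ih =>
      rw [ih (by omega), sum_wzF_succ, sum_range_succ _ j,
        show 2 * (K - (j + 1)) + 1 + 2 = 2 * (K - j) + 1 by omega,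
        show 2 * (K - (j + 1)) + 1 + 1 = 2 * (K - j) by omega]
      ring
  simpa using key K le_rfl

/-! ### Divisibility of rational numbers by powers of a prime -/

/-- `PowDvd p m x`: the rational number `x` is `p ^ m` times a fraction whose denominator is prime
to `p`. The exponent `m` may be negative, so that denominators can be tracked as well. -/
def PowDvd (p : ℕ) (m : ℤ) (x : ℚ) : Prop := padicNorm p x ≤ (p : ℚ) ^ (-m)

namespace PowDvd

lemma neg {p : ℕ} {m : ℤ} {x : ℚ} (hx : PowDvd p m x) : PowDvd p m (-x) := by
  rwa [PowDvd, padicNorm.neg]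

variable {p : ℕ} [hp : Fact p.Prime] {m n : ℤ} {x y : ℚ}

lemma mul (hx : PowDvd p m x) (hy : PowDvd p n y) : PowDvd p (m + n) (x * y) := by
  have h0 : (p : ℚ) ≠ 0 := by exact_mod_cast hp.out.ne_zero
  rw [PowDvd, padicNorm.mul, neg_add, zpow_add₀ h0]
  exact mul_le_mul hx hy (padicNorm.nonneg _) (by positivity)

lemma pow (hx : PowDvd p m x) (k : ℕ) : PowDvd p (k * m) (x ^ k) := by
  induction k with
  | zero => simp [PowDvd]
  | succ k ih =>
    rw [pow_succ, show ((k + 1 : ℕ) : ℤ) * m = k * m + m by push_cast; ring]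
    exact ih.mul hx

lemma mono (hx : PowDvd p m x) (h : n ≤ m) : PowDvd p n x :=
  hx.trans (zpow_le_zpow_right₀ (by exact_mod_cast hp.out.one_le) (by omega))

lemma add (hx : PowDvd p m x) (hy : PowDvd p m y) : PowDvd p m (x + y) :=
  padicNorm.nonarchimedean.trans (max_le hx hy)

lemma sub (hx : PowDvd p m x) (hy : PowDvd p m y) : PowDvd p m (x - y) := by
  rw [sub_eq_add_neg]; exact hx.add hy.neg

lemma sum {s : Finset ℕ} {f : ℕ → ℚ} (h : ∀ i ∈ s, PowDvd p m (f i)) :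
    PowDvd p m (∑ i ∈ s, f i) :=
  padicNorm.sum_le' h (by positivity)

lemma intCast (z : ℤ) : PowDvd p 0 z := by simpa [PowDvd] using padicNorm.of_int z

lemma natCast (a : ℕ) : PowDvd p 0 a := by exact_mod_cast intCast (p := p) (a : ℤ)

lemma of_dvd {a : ℕ} (k : ℕ) (h : p ^ k ∣ a) : PowDvd p k a := by
  have := (padicNorm.dvd_iff_norm_le (p := p) (n := k) (z := (a : ℤ))).1 (by exact_mod_cast h)
  simpa [PowDvd] using this

lemma self : PowDvd p 1 p := by simpa using of_dvd (p := p) (a := p) 1 (by simp)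

lemma inv_natCast {a : ℕ} (ha : ¬ p ∣ a) : PowDvd p 0 (a : ℚ)⁻¹ := by
  have h1 : padicNorm p a = 1 := (padicNorm.nat_eq_one_iff a).2 ha
  have h2 : padicNorm p (a : ℚ)⁻¹ = 1 := by
    rw [← one_div, padicNorm.div, h1]; simp
  simp [PowDvd, h2]

lemma inv_intCast {a : ℤ} (ha : ¬ (p : ℤ) ∣ a) : PowDvd p 0 (a : ℚ)⁻¹ := by
  have h1 : padicNorm p a = 1 := (padicNorm.int_eq_one_iff a).2 ha
  have h2 : padicNorm p (a : ℚ)⁻¹ = 1 := by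
    rw [← one_div, padicNorm.div, h1]; simp
  simp [PowDvd, h2]

/-- For `c, a < p` the factorial of `p * c + a` has exactly `c` factors `p`. -/
lemma inv_factorial {a c : ℕ} (ha : a < p) (hc : c < p) :
    PowDvd p (-c) ((p * c + a)! : ℚ)⁻¹ := by
  have hv : padicValNat p (p * c + a)! = c := by
    rw [padicValNat_factorial_mul_add _ ha, padicValNat_factorial_mul,
      padicValNat.eq_zero_of_not_dvd (fun h => hc.not_ge (hp.out.dvd_factorial.1 h)), zero_add]
  have h0 : ((p * c + a)! : ℚ) ≠ 0 := by positivity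
  rw [PowDvd, padicNorm.eq_zpow_of_nonzero (inv_ne_zero h0), padicValRat.inv,
    padicValRat.of_nat, hv]

lemma ratModEq {k : ℕ} (h : PowDvd p k (x - y)) : RatModEq (p ^ k) x y := by
  have h0 : (p : ℚ) ≠ 0 := by exact_mod_cast hp.out.ne_zero
  set z := (x - y) / (p : ℚ) ^ k with hz
  have hz' : x - y = ((p ^ k : ℕ) : ℚ) * z := by rw [hz]; push_cast; field_simp
  have h1 : padicNorm p z ≤ 1 := by
    have h2 : padicNorm p ((p : ℚ) ^ k) = (p : ℚ) ^ (-k : ℤ) := by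
      rw [IsAbsoluteValue.abv_pow (padicNorm p), padicNorm.padicNorm_p hp.out.one_lt, zpow_neg,
        zpow_natCast, inv_pow]
    rw [hz, padicNorm.div, h2, div_le_one (by have := hp.out.pos; positivity)]
    exact h
  refine ⟨z.num, z.den, z.den_pos, ?_, by rw [hz', Rat.num_div_den]⟩
  refine Nat.Coprime.pow_right _ ((Nat.coprime_comm.1 ?_))
  rw [hp.out.coprime_iff_not_dvd]
  intro hd
  have h3 : padicNorm p z.den < 1 := (padicNorm.nat_lt_one_iff _).2 hd
  have h4 : padicNorm p z.num = padicNorm p z * padicNorm p z.den := by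
    rw [← padicNorm.mul, Rat.mul_den_eq_num]
  have h5 : padicNorm p z.num < 1 := by
    rw [h4]
    exact mul_lt_one_of_nonneg_of_lt_one_right h1 (padicNorm.nonneg _) h3
  have h6 : (p : ℤ) ∣ z.num := (padicNorm.int_lt_one_iff _).1 h5
  exact hp.out.one_lt.ne'
    (Nat.eq_one_of_dvd_coprimes z.reduced (Int.natCast_dvd.1 h6) hd)

end PowDvd

section OddPrime

variable {p K : ℕ} [hp : Fact p.Prime]

/-! ### Divisibility of the boundary terms -/

lemma powDvd_half (hK : p = 2 * K + 1) : PowDvd p 0 (1 / 2 : ℚ) := by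
  have h : ¬ p ∣ 2 := fun h => by
    have := Nat.le_of_dvd (by norm_num) h
    have := hp.out.two_le
    omega
  simpa using PowDvd.inv_natCast h

lemma powDvd_rising_half (hK : p = 2 * K + 1) (n : ℕ) : PowDvd p 0 (rising (1 / 2) n) := by
  induction n with
  | zero => simpa [rising_zero] using PowDvd.natCast (p := p) 1
  | succ n ih =>
    rw [rising_succ]
    simpa using ih.mul ((powDvd_half hK).add (PowDvd.natCast n))

lemma powDvd_rising_half_add (hK : p = 2 * K + 1) {m : ℤ} {a : ℕ}
    (h : PowDvd p m (rising (1 / 2) a)) {b : ℕ} (hab : a ≤ b) :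
    PowDvd p m (rising (1 / 2) b) := by
  induction b, hab using Nat.le_induction with
  | base => exact h
  | succ n _ ih =>
    rw [rising_succ]
    simpa using ih.mul ((powDvd_half hK).add (PowDvd.natCast n))

/-- The factor `1 / 2 + K = p / 2`. -/
lemma powDvd_one_rising_half (hK : p = 2 * K + 1) {n : ℕ} (hn : K + 1 ≤ n) :
    PowDvd p 1 (rising (1 / 2) n) := by
  refine powDvd_rising_half_add hK ?_ hn
  rw [rising_succ, show (1 / 2 + K : ℚ) = p * (1 / 2) by rw [hK]; push_cast; ring]
  simpa using (powDvd_rising_half hK K).mul (PowDvd.self.mul (powDvd_half hK))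

/-- The factors `1 / 2 + K = p / 2` and `1 / 2 + (3 * K + 1) = 3 * p / 2`. -/
lemma powDvd_two_rising_half (hK : p = 2 * K + 1) {n : ℕ} (hn : 3 * K + 2 ≤ n) :
    PowDvd p 2 (rising (1 / 2) n) := by
  refine powDvd_rising_half_add hK ?_ hn
  rw [show 3 * K + 2 = 3 * K + 1 + 1 by ring, rising_succ,
    show (1 / 2 + (3 * K + 1 : ℕ) : ℚ) = p * ((3 : ℕ) * (1 / 2)) by rw [hK]; push_cast; ring]
  simpa using (powDvd_one_rising_half hK (show K + 1 ≤ 3 * K + 1 by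
    have := hp.out.two_le; omega)).mul
      (PowDvd.self.mul ((PowDvd.natCast 3).mul (powDvd_half hK)))

lemma powDvd_inv_rising_half (hK : p = 2 * K + 1) {n : ℕ} (hn : n ≤ K) :
    PowDvd p 0 (rising (1 / 2) n)⁻¹ := by
  induction n with
  | zero => simpa [rising_zero] using PowDvd.natCast (p := p) 1
  | succ n ih =>
    have h : ¬ p ∣ 2 * n + 1 := fun h => by
      have := Nat.le_of_dvd (by omega) h
      omega
    have h' : (1 / 2 + n : ℚ)⁻¹ = ((2 * n + 1 : ℕ) : ℚ)⁻¹ * (2 : ℕ) := by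
      push_cast; field_simp; ring
    rw [rising_succ, mul_inv, h']
    simpa using (ih (by omega)).mul ((PowDvd.inv_natCast h).mul (PowDvd.natCast 2))

lemma wzG_powDvd (hK : p = 2 * K + 1) {k : ℕ} (hk : k < K) :
    PowDvd p 5 (wzG k (2 * (K - k))) := by
  obtain ⟨d, rfl⟩ : ∃ d, K = k + d := ⟨K - k, by omega⟩
  have hd : 1 ≤ d := by omega
  rw [Nat.add_sub_cancel_left]
  have e1 : 4 * k + 2 * (2 * d) + 2 = p * 2 + 0 := by omega
  have e2 : 3 * k + 2 * (2 * d) + 1 = p * 1 + (k + 2 * d) := by omega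
  have e3 : 2 * k + 2 * d + 1 = p := by omega
  have hp3 : 2 < p := by omega
  have f1 : PowDvd p 2 (rising (1 / 2) (4 * k + 2 * (2 * d) + 2)) :=
    powDvd_two_rising_half hK (by omega)
  have f2 : PowDvd p (2 * 1) (rising (1 / 2) (2 * k + 2 * d + 1) ^ 2) :=
    (powDvd_one_rising_half hK (by omega)).pow 2
  have f3 : PowDvd p (2 * 1) (rising (1 / 2) (k + 2 * d) ^ 2) :=
    (powDvd_one_rising_half hK (by omega)).pow 2
  have f4 : PowDvd p 2 ((4 * k + 3 * (2 * d))! : ℚ) := by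
    refine PowDvd.of_dvd 2 (dvd_trans ?_ (Nat.factorial_dvd_factorial
      (show 2 * p ≤ 4 * k + 3 * (2 * d) by omega)))
    rw [two_mul, sq]
    exact (mul_dvd_mul (Nat.dvd_factorial (by omega) le_rfl)
      (Nat.dvd_factorial (by omega) le_rfl)).trans (Nat.factorial_mul_factorial_dvd_factorial_add p p)
  have f5 : PowDvd p 1 (2 * k + (2 * d : ℕ) + 1 : ℚ) := by
    have : (2 * k + (2 * d : ℕ) + 1 : ℚ) = (p : ℚ) := by rw [← e3]; push_cast; ring
    rw [this]; exact PowDvd.self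
  have f6 : PowDvd p 0 (3 * wzCert (2 * k + (2 * d : ℕ) + 1) k) := by
    have : (3 * wzCert (2 * k + (2 * d : ℕ) + 1) k : ℚ) =
        ((3 * (48 + 208 * k + 288 * k ^ 2 + 128 * k ^ 3
          - (184 + 544 * k + 384 * k ^ 2) * (2 * k + (2 * d : ℕ) + 1)
          + (208 + 320 * k) * (2 * k + (2 * d : ℕ) + 1) ^ 2
          - 64 * (2 * k + (2 * d : ℕ) + 1) ^ 3) : ℤ) : ℚ) := by
      rw [wzCert]; push_cast; ring
    rw [this]; exact PowDvd.intCast _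
  have f7 : PowDvd p (-(2 : ℕ)) ((4 * k + 2 * (2 * d) + 2)! : ℚ)⁻¹ := by
    rw [e1]; exact PowDvd.inv_factorial (by omega) hp3
  have f8 : PowDvd p (2 * -(1 : ℕ)) (((3 * k + 2 * (2 * d) + 1)! : ℚ)⁻¹ ^ 2) := by
    rw [e2]; exact (PowDvd.inv_factorial (by omega) hp.out.one_lt).pow 2
  have hs : ∀ {a : ℕ}, a < p → PowDvd p 0 (a ! : ℚ)⁻¹ := fun {a} ha => by
    simpa using PowDvd.inv_factorial (p := p) (c := 0) ha hp.out.pos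
  have f9 : PowDvd p (2 * 0) (((k + 2 * d)! : ℚ)⁻¹ ^ 2) := (hs (by omega)).pow 2
  have f10 : PowDvd p 0 (((2 * d)! : ℚ)⁻¹) := hs (by omega)
  have f11 : PowDvd p (2 * 0) ((rising (1 / 2) (k + 1))⁻¹ ^ 2) :=
    (powDvd_inv_rising_half hK (by omega)).pow 2
  have f12 : PowDvd p 0 ((-1 : ℚ) ^ (2 * d + 1)) := by
    exact_mod_cast PowDvd.intCast (p := p) ((-1) ^ (2 * d + 1))
  have := ((((((((((f12.mul f1).mul f2).mul f3).mul f4).mul f5).mul f6).mul f7).mul f8).mul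
    f9).mul f10).mul f11
  norm_num at this
  convert this using 1
  rw [wzG, div_eq_mul_inv]
  simp only [mul_inv]
  push_cast
  ring

end OddPrime

/-! ### The surviving term as a product -/

lemma rising_centred (x : ℚ) (K : ℕ) :
    rising (x - K) (2 * K + 1) = x * ∏ i ∈ range K, (x ^ 2 - ((i : ℚ) + 1) ^ 2) := by
  induction K with
  | zero => simp [rising_succ, rising_zero]
  | succ K ih =>
    have h : rising (x - (K + 1 : ℕ)) (2 * (K + 1) + 1)
        = (x - (K + 1)) * rising (x - K) (2 * K + 1) * (x + (K + 1)) := by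
      rw [show 2 * (K + 1) + 1 = 1 + (2 * K + 1) + 1 by ring, rising_succ, rising_add,
        rising_succ, rising_zero]
      push_cast
      rw [show x - (K + 1) + 1 = x - K by ring]
      ring
    rw [h, ih, prod_range_succ]
    ring

/-- The three shifted factorials in the surviving term are centred at `p / 2`, `3 * p / 2`
and `p`, so each is an odd function times a product over squares. -/
lemma wzF_offset_zero_eq_prod {p K : ℕ} (hK : p = 2 * K + 1) (hpos : 0 < K) :
    wzF K 0 = 9 * p ^ 2 * ∏ i ∈ range K,
      ((p : ℚ) ^ 2 / 4 - ((i : ℚ) + 1) ^ 2) ^ 3 * (9 * (p : ℚ) ^ 2 / 4 - ((i : ℚ) + 1) ^ 2)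
        / (((p : ℚ) ^ 2 - ((i : ℚ) + 1) ^ 2) ^ 2 * (((i : ℚ) + 1) ^ 2) ^ 2) := by
  have hpK : (p : ℚ) = 2 * K + 1 := by rw [hK]; push_cast; ring
  set A := ∏ i ∈ range K, ((p : ℚ) ^ 2 / 4 - ((i : ℚ) + 1) ^ 2) with hA
  set B := ∏ i ∈ range K, (9 * (p : ℚ) ^ 2 / 4 - ((i : ℚ) + 1) ^ 2) with hB
  set C := ∏ i ∈ range K, ((p : ℚ) ^ 2 - ((i : ℚ) + 1) ^ 2) with hC
  have hfac : (K ! : ℚ) = ∏ i ∈ range K, ((i : ℚ) + 1) := by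
    rw [← prod_range_add_one_eq_factorial]; push_cast; rfl
  rw [prod_div_distrib, prod_mul_distrib, prod_mul_distrib, prod_pow, prod_pow, prod_pow,
    prod_pow, ← hfac, ← hA, ← hB, ← hC]
  have r1 : rising (1 / 2) p = p / 2 * A := by
    have h := rising_centred (p / 2) K
    rw [show (p / 2 - K : ℚ) = 1 / 2 by rw [hpK]; ring, ← hK] at h
    rw [h, hA]
    congr 1
    exact prod_congr rfl fun i _ => by ring
  have r2 : rising (1 / 2) (2 * p) = p / 2 * A * (3 * p / 2 * B) := by
    have h := rising_centred (3 * p / 2) K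
    rw [show (3 * p / 2 - K : ℚ) = 1 / 2 + p by rw [hpK]; ring, ← hK] at h
    rw [two_mul, rising_add, r1, h, hB]
    congr 2
    exact prod_congr rfl fun i _ => by ring
  have r3 : ((3 * K + 1)! : ℚ) = K ! * (p * C) := by
    have h := rising_centred p K
    rw [show (p - K : ℚ) = K + 1 by rw [hpK]; ring] at h
    rw [show 3 * K + 1 = K + (2 * K + 1) by ring, factorial_add_eq_mul_rising, h]
  have r4 : rising (1 / 2) p = rising (1 / 2) (2 * K) * (1 / 2 + 2 * K) := by
    rw [hK, rising_succ]; push_cast; ring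
  have r5 : rising (1 / 2) (2 * p)
      = rising (1 / 2) (4 * K) * (1 / 2 + 4 * K) * (3 / 2 + 4 * K) := by
    rw [hK, show 2 * (2 * K + 1) = 4 * K + 1 + 1 by ring, rising_succ, rising_succ]
    push_cast; ring
  have hK0 : (K : ℚ) ≠ 0 := by positivity
  have hp0 : (p : ℚ) ≠ 0 := by rw [hpK]; positivity
  have hC0 : C ≠ 0 := by
    intro h0
    rw [h0] at r3
    simp [factorial_ne_zero] at r3
  have hr := (rising_pos (show (0 : ℚ) < 1 / 2 by norm_num) K).ne'
  have hF : wzF K 0 = 48 * rising (1 / 2) (2 * p) * rising (1 / 2) p ^ 2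
      / ((3 * K + 1)! * K !) ^ 2 := by
    simp only [wzF, hpos.ne', false_and, if_false, wzNum, mul_zero, add_zero, r4, r5]
    push_cast
    field_simp
    ring
  rw [hF, r2, r1, r3]
  field_simp
  ring

/-! ### The surviving term modulo `p ^ 5` -/

section OddPrime

variable {p K : ℕ} [hp : Fact p.Prime]

/-- For `p > 3` the squares of the inverses in `ZMod p` sum to zero, and each occurs twice;
the factor `9` takes care of `p = 3`. -/
lemma powDvd_sum_inv_sq (hK : p = 2 * K + 1) :
    PowDvd p 1 (9 * ∑ i ∈ range K, (((i : ℚ) + 1) ^ 2)⁻¹) := by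
  have hinv : ∀ i ∈ range K, PowDvd p 0 (((i : ℚ) + 1) ^ 2)⁻¹ := fun i hi => by
    have h : ¬ p ∣ (i + 1) := fun h => by
      have := Nat.le_of_dvd (by omega) h
      have := mem_range.1 hi
      omega
    simpa using (PowDvd.inv_natCast h).pow 2
  rcases eq_or_ne p 3 with h3 | h3
  · have h9 : PowDvd p 1 ((9 : ℕ) : ℚ) := by
      exact_mod_cast PowDvd.of_dvd (p := p) (a := 9) 1 (by rw [h3]; norm_num)
    simpa using h9.mul (PowDvd.sum hinv)
  · have hp5 : 4 < p := by
      have := hp.out.two_le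
      omega
    -- The sum over all nonzero residues vanishes as `p - 1` does not divide `2`.
    have hall : ∑ j ∈ range (2 * K), ((j : ZMod p) + 1)⁻¹ ^ 2 = 0 := by
      have hu := FiniteField.sum_pow_lt_card_sub_one (ZMod p) (p - 3) (by
        rw [ZMod.card]; omega)
      have hx : ∀ x : ZMod p, x ^ (p - 3) = x⁻¹ ^ 2 := fun x => by
        rcases eq_or_ne x 0 with rfl | h0
        · simp; omega
        · have h1 := ZMod.pow_card_sub_one_eq_one h0
          rw [show p - 1 = p - 3 + 2 by omega, pow_add] at h1
          field_simp
          exact h1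
      have hr : ∑ j ∈ range p, (j : ZMod p)⁻¹ ^ 2 = ∑ x : ZMod p, x⁻¹ ^ 2 :=
        sum_nbij' (fun j => (j : ZMod p)) ZMod.val (by simp)
          (fun x _ => mem_range.2 (ZMod.val_lt x))
          (fun j hj => ZMod.val_cast_of_lt (mem_range.1 hj))
          (fun x _ => ZMod.natCast_zmod_val x) (fun _ _ => rfl)
      simp only [hx] at hu
      rw [hu, show range p = range (2 * K + 1) by rw [hK], sum_range_succ'] at hr
      simpa using hr
    have hhalf : ∑ i ∈ range K, ((i : ZMod p) + 1)⁻¹ ^ 2 = 0 := by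
      have hp0 : ((2 * K + 1 : ℕ) : ZMod p) = 0 := by rw [← hK]; simp
      push_cast at hp0
      rw [two_mul, sum_range_add] at hall
      have h2 : ∑ i ∈ range K, (((K + i : ℕ) : ZMod p) + 1)⁻¹ ^ 2
          = ∑ i ∈ range K, ((i : ZMod p) + 1)⁻¹ ^ 2 := by
        rw [← sum_range_reflect]
        refine sum_congr rfl fun i hi => ?_
        have hi' := mem_range.1 hi
        have : (((K + (K - 1 - i) : ℕ) : ZMod p) + 1) = -((i : ZMod p) + 1) := by
          rw [show K + (K - 1 - i) = 2 * K - (i + 1) by omega,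
            Nat.cast_sub (by omega)]
          push_cast
          linear_combination hp0
        rw [this, inv_neg, neg_sq]
      rw [h2, ← two_mul] at hall
      refine (mul_eq_zero.1 hall).resolve_left fun h => ?_
      have : p ∣ 2 := (ZMod.natCast_eq_zero_iff 2 p).1 (by exact_mod_cast h)
      have := Nat.le_of_dvd (by norm_num) this
      omega
    -- Clear denominators to pass between `ℚ` and `ZMod p`.
    set N : ℕ := ∑ i ∈ range K, (K ! / (i + 1)) ^ 2 with hN
    have hdvd : ∀ i ∈ range K, (i + 1) ∣ K ! := fun i hi =>
      Nat.dvd_factorial (by omega) (by have := mem_range.1 hi; omega)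
    have hNp : p ∣ N := by
      rw [← ZMod.natCast_eq_zero_iff, hN]
      have : ((K ! : ZMod p)) ^ 2 * ∑ i ∈ range K, ((i : ZMod p) + 1)⁻¹ ^ 2 = 0 := by
        rw [hhalf, mul_zero]
      rw [← this, mul_sum]
      push_cast
      refine sum_congr rfl fun i hi => ?_
      have hne : ((i : ZMod p) + 1) ≠ 0 := fun h => by
        have h' : p ∣ i + 1 := (ZMod.natCast_eq_zero_iff (i + 1) p).1 (by exact_mod_cast h)
        have := Nat.le_of_dvd (by omega) h'
        have := mem_range.1 hi
        omega
      obtain ⟨c, hc⟩ := hdvd i hi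
      rw [hc, Nat.mul_div_cancel_left _ (by omega)]
      push_cast
      field_simp
    have hNQ : ∑ i ∈ range K, (((i : ℚ) + 1) ^ 2)⁻¹ = (N : ℚ) * ((K ! : ℚ)⁻¹) ^ 2 := by
      rw [hN]
      push_cast
      rw [sum_mul]
      refine sum_congr rfl fun i hi => ?_
      obtain ⟨c, hc⟩ := hdvd i hi
      have hc0 : (c : ℚ) ≠ 0 := by
        have : c ≠ 0 := fun h => K.factorial_ne_zero (by rw [hc, h, mul_zero])
        exact_mod_cast this
      rw [hc, Nat.mul_div_cancel_left _ (by omega)]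
      push_cast
      field_simp
    have hfac : PowDvd p 0 (K ! : ℚ)⁻¹ := PowDvd.inv_natCast fun h => by
      have := hp.out.dvd_factorial.1 h
      omega
    rw [hNQ]
    simpa using (PowDvd.natCast (p := p) 9).mul
      ((PowDvd.of_dvd (p := p) (a := N) 1 (by simpa using hNp)).mul (hfac.pow 2))

/-- Each factor of the surviving term is `1 - p² / i² + O(p⁴)`. -/
lemma powDvd_factor_sub (hK : p = 2 * K + 1) {i : ℕ} (hi : i < K) :
    PowDvd p 4 (((p : ℚ) ^ 2 / 4 - ((i : ℚ) + 1) ^ 2) ^ 3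
        * (9 * (p : ℚ) ^ 2 / 4 - ((i : ℚ) + 1) ^ 2)
        / (((p : ℚ) ^ 2 - ((i : ℚ) + 1) ^ 2) ^ 2 * (((i : ℚ) + 1) ^ 2) ^ 2)
      - (1 - (p : ℚ) ^ 2 * (((i : ℚ) + 1) ^ 2)⁻¹)) := by
  have hi1 : ¬ p ∣ (i + 1) := fun h => by
    have := Nat.le_of_dvd (by omega) h
    omega
  have hi2 : ¬ (p : ℤ) ∣ ((p : ℤ) ^ 2 - ((i + 1 : ℕ) : ℤ) ^ 2) := fun h => by
    rw [dvd_sub_right (dvd_pow_self _ two_ne_zero)] at h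
    exact hi1 (by exact_mod_cast hp.out.dvd_of_dvd_pow (by exact_mod_cast h))
  have h1 : PowDvd p 0 ((((i : ℚ) + 1))⁻¹) := by exact_mod_cast PowDvd.inv_natCast hi1
  have h2 : PowDvd p 0 (((p : ℚ) ^ 2 - ((i : ℚ) + 1) ^ 2)⁻¹) := by
    exact_mod_cast PowDvd.inv_intCast hi2
  have hne1 : ((i : ℚ) + 1) ≠ 0 := by positivity
  have hne2 : ((p : ℚ) ^ 2 - ((i : ℚ) + 1) ^ 2) ≠ 0 := fun h => hi2 (by
    have : ((p : ℤ) ^ 2 - ((i + 1 : ℕ) : ℤ) ^ 2) = 0 := by exact_mod_cast h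
    rw [this]; exact dvd_zero _)
  -- With `y = p²` and `a = i²`, the difference has denominator `(y - a)² a²` and numerator
  -- `(y/4 - a)³ (9y/4 - a) - (a - y) a (y - a)² = (9/256) y² (y² + 16 a y - 32 a²)`.
  have hz : PowDvd p 0 ((9 * (-32 * ((i : ℚ) + 1) ^ 4 + 16 * ((i : ℚ) + 1) ^ 2 * (p : ℚ) ^ 2
      + (p : ℚ) ^ 4))) := by
    have h := PowDvd.intCast (p := p)
      (9 * (-32 * ((i : ℤ) + 1) ^ 4 + 16 * ((i : ℤ) + 1) ^ 2 * (p : ℤ) ^ 2 + (p : ℤ) ^ 4))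
    push_cast at h
    exact h
  have := ((((PowDvd.self (p := p)).pow 4).mul ((powDvd_half hK).pow 8)).mul hz).mul
    ((h1.pow 4).mul (h2.pow 2))
  norm_num at this
  convert this using 1
  field_simp
  ring

lemma powDvd_prod_sub {f g : ℕ → ℚ} (hf : ∀ i < K, PowDvd p 4 (f i - (1 - (p : ℚ) ^ 2 * g i)))
    (hg : ∀ i < K, PowDvd p 0 (g i)) :
    PowDvd p 4 (∏ i ∈ range K, f i - (1 - (p : ℚ) ^ 2 * ∑ i ∈ range K, g i)) := by
  induction K with
  | zero => simp [PowDvd]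
  | succ K ih =>
    have h1 := ih (fun i hi => hf i (by omega)) (fun i hi => hg i (by omega))
    have h2 := hf K (by omega)
    have h3 := hg K (by omega)
    have hp2 : PowDvd p 2 ((p : ℚ) ^ 2) := by simpa using (PowDvd.self (p := p)).pow 2
    have hone : PowDvd p 0 (1 : ℚ) := by simpa using PowDvd.natCast (p := p) 1
    have hs : PowDvd p 0 (∑ i ∈ range K, g i) :=
      PowDvd.sum fun i hi => hg i (by have := mem_range.1 hi; omega)
    have hfK : PowDvd p 0 (f K) := by
      have := (h2.mono (show (0 : ℤ) ≤ 4 by norm_num)).add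
        (hone.sub ((hp2.mul h3).mono (show (0 : ℤ) ≤ 2 + 0 by norm_num)))
      simpa using this
    have h4 : PowDvd p 4 (((p : ℚ) ^ 2 * ∑ i ∈ range K, g i) * ((p : ℚ) ^ 2 * g K)) := by
      simpa using (hp2.mul hs).mul (hp2.mul h3)
    have h5 : PowDvd p 4 ((1 - (p : ℚ) ^ 2 * ∑ i ∈ range K, g i)
        * (f K - (1 - (p : ℚ) ^ 2 * g K))) := by
      simpa using (hone.sub ((hp2.mul hs).mono (show (0 : ℤ) ≤ 2 + 0 by norm_num))).mul h2
    have h6 : PowDvd p 4 ((∏ i ∈ range K, f i - (1 - (p : ℚ) ^ 2 * ∑ i ∈ range K, g i)) * f K) := by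
      simpa using h1.mul hfK
    convert (h6.add h5).add h4 using 1
    rw [prod_range_succ, sum_range_succ]
    ring

lemma wzF_offset_zero_powDvd (hK : p = 2 * K + 1) :
    PowDvd p 5 (wzF K 0 - 9 * (p : ℚ) ^ 2) := by
  have hpos : 0 < K := by have := hp.out.two_le; omega
  have hprod := powDvd_prod_sub (fun i hi => powDvd_factor_sub hK hi) (fun i hi => by
    have h : ¬ p ∣ (i + 1) := fun h => by
      have := Nat.le_of_dvd (by omega) h
      omega
    simpa using (PowDvd.inv_natCast h).pow 2)
  have hp2 : PowDvd p 2 ((p : ℚ) ^ 2) := by simpa using (PowDvd.self (p := p)).pow 2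
  have h9 : PowDvd p 0 (9 : ℚ) := by simpa using PowDvd.natCast (p := p) 9
  have h1 := ((h9.mul hp2).mul hprod).mono (show (5 : ℤ) ≤ 0 + 2 + 4 by norm_num)
  have h2 : PowDvd p 5 _ := (hp2.mul hp2).mul (powDvd_sum_inv_sq hK)
  convert h1.sub h2 using 1
  rw [wzF_offset_zero_eq_prod hK hpos]
  ring

lemma sum_wzF_zero_powDvd (hK : p = 2 * K + 1) :
    PowDvd p 5 (∑ n ∈ range p, wzF 0 n - 9 * (p : ℚ) ^ 2) := by
  have hG : PowDvd p 5 (∑ k ∈ range K, wzG k (2 * (K - k))) :=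
    PowDvd.sum fun k hk => wzG_powDvd hK (mem_range.1 hk)
  convert (wzF_offset_zero_powDvd hK).sub hG using 1
  rw [show range p = range (2 * K + 1) by rw [hK], sum_wzF_zero]
  ring

end OddPrime

theorem theorem1p2 (p : ℕ) (hp : p.Prime) (hodd : Odd p) :
    RatModEq (p ^ 5)
      (∑ k ∈ Finset.range p,
        (-1 : ℚ) ^ k * (172 * (k : ℚ) ^ 2 + 75 * (k : ℚ) + 9) / 2 ^ (12 * k)
          * ((2 * k).choose k : ℚ) ^ 3 * ((3 * k).choose k : ℚ) * ((4 * k).choose (2 * k) : ℚ))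
      (9 * (p : ℚ) ^ 2)
    ∧ RatModEq (p ^ 5)
      (∑ n ∈ Finset.range p,
        (rising (1 / 2) n * rising (1 / 3) n * rising (2 / 3) n * rising (1 / 4) n
            * rising (3 / 4) n) / rising 1 n ^ 5
          * (-1 : ℚ) ^ n * (172 * (n : ℚ) ^ 2 + 75 * (n : ℚ) + 9) * (27 / 16 : ℚ) ^ n)
      (9 * (p : ℚ) ^ 2) := by
  have : Fact p.Prime := ⟨hp⟩
  obtain ⟨K, hK⟩ := hodd
  have h := sum_wzF_zero_powDvd hK
  refine ⟨PowDvd.ratModEq (k := 5) ?_, PowDvd.ratModEq (k := 5) ?_⟩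
  · rw [sum_congr rfl fun k _ => (binomial_summand_eq k).trans (wzF_zero_left k).symm]
    exact h
  · rw [sum_congr rfl fun n _ => (hypergeometric_summand_eq n).trans (wzF_zero_left n).symm]
    exact h
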